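/- **Model.** Let $\mathcal U$ be the uniform distribution on $\{0,1\}^n$ and $\|g\|_2=(\mathbf E_{x\sim\mathcal U}[g(x)^2])^{1/2}$. A learning algorithm on $\{0,1\}^n$ is a randomized, adaptive procedure of unlimited computational power. At each step, depending on its internal randomness and on the labeled points received so far, it either asks for a random example $(x,f(x))$ of the unknown target $f$, with a fresh independent $x\sim\mathcal U$; or makes a value query, receiving $f(x)$ for a point $x$ of its choice; or stops and returns a hypothesis $h:\{0,1\}^n\to\mathbb R$. It PAC learns a class $\mathcal F$ of functions $\{0,1\}^n\to\mathbb R$ to $\ell_2$ error $\varepsilon$ if for every $f\in\mathcal F$, with probability at least $2/3$ (over the examples and its internal randomness), it returns $h$ with $\|f-h\|_2\le\varepsilon$. A function $f:\{0,1\}^n\to\mathbb R$ is monotone if $f(x)\le f(y)$ whenever $x\le y$ coordinatewise, and submodular if $f(x\vee y)+f(x\wedge y)\le f(x)+f(y)$ for all $x,y$ (coordinatewise maximum and minimum). **Theorem.** Any algorithm that PAC learns all monotone submodular functions with range in $[0,1]$ to $\ell_2$ error $\varepsilon$ requires $2^{\Omega(\varepsilon^{-4/5})}$ random examples of, or value queries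 to, the target function. Precisely: there are absolute constants $c,C,\varepsilon_0>0$ such that for every $0<\varepsilon\le\varepsilon_0$, every integer $n\ge C\varepsilon^{-4/5}$, every learning algorithm on $\{0,1\}^n$ that PAC learns the class of all monotone submodular functions $f:\{0,1\}^n\to[0,1]$ to $\ell_2$ error $\varepsilon$, and every integer $q\ge 0$: if for every target $f$ in this class the algorithm almost surely stops after at most $q$ requests (random examples and value queries counted together), then $$q\ \ge\ 2^{c\,\varepsilon^{-4/5}}.$$ -/

import Mathlib

open MeasureTheory

noncomputable section

namespace SubmodularLearning

/-- The Boolean cube `{0,1}^n`, ordered coordinatewise; a point is the indicator of a subset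
of `[n]`, with `⊔` the union and `⊓` the intersection. -/
abbrev Cube (n : ℕ) : Type := Fin n → Bool

/-- Submodularity, `f (A ∪ B) + f (A ∩ B) ≤ f A + f B`. -/
def Submodular {n : ℕ} (f : Cube n → ℝ) : Prop :=
  ∀ x y : Cube n, f (x ⊔ y) + f (x ⊓ y) ≤ f x + f y

/-- The class of all monotone submodular functions on `{0,1}^n` with range in `[0,1]`. -/
def monotoneSubmodular (n : ℕ) : Set (Cube n → ℝ) :=
  {f | Monotone f ∧ Submodular f ∧ ∀ x, f x ∈ Set.Icc (0 : ℝ) 1}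

/-- The norm `‖f‖₂ = (E_{x ∼ U} [f(x)²])^{1/2}` for the uniform distribution `U` on the cube. -/
def l2norm {n : ℕ} (f : Cube n → ℝ) : ℝ :=
  Real.sqrt ((∑ x : Cube n, f x ^ 2) / 2 ^ n)

/-- The uniform distribution on the cube. -/
def uniform (n : ℕ) : Measure (Cube n) :=
  (PMF.uniformOfFintype (Cube n)).toMeasure

/-- What a learning algorithm can do next: ask for a random labeled example, ask for the value
of the target at a point of its choice, or stop and return a hypothesis. -/
inductive Action (n : ℕ) : Type
  | drawExample : Action n
  | valueQuery (x : Cube n) : Action n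
  | output (h : Cube n → ℝ) : Action n

/-- An action as an element of a disjoint union. -/
def Action.toSum {n : ℕ} : Action n → Unit ⊕ Cube n ⊕ (Cube n → ℝ)
  | .drawExample => Sum.inl ()
  | .valueQuery x => Sum.inr (Sum.inl x)
  | .output h => Sum.inr (Sum.inr h)

instance (n : ℕ) : MeasurableSpace (Action n) :=
  MeasurableSpace.comap Action.toSum inferInstance

/-- A randomized, adaptive learning algorithm for real-valued functions on `{0,1}^n`, with
unbounded computational power. Its internal randomness is a seed drawn from an arbitrary
probability space. The next action is an arbitrary (measurable in the seed) function of the seed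
and of the list of labeled points received so far, in the order in which they were received. -/
structure Learner (n : ℕ) where
  Seed : Type
  [instSeed : MeasurableSpace Seed]
  law : Measure Seed
  [isProb : IsProbabilityMeasure law]
  step : Seed → List (Cube n × ℝ) → Action n
  measurable_step : ∀ l : List (Cube n × ℝ), Measurable fun s => step s l

attribute [instance] Learner.instSeed Learner.isProb

namespace Learner

variable {n : ℕ} (A : Learner n)

/-- The labeled points received by `A` in its first `i` requests about the target `f` (fewer, if
`A` stops before), with seed `s` and random points `X 0, X 1, …`; the `i`-th request, if it is
for a random example, is answered with the fresh point `X i`, labeled by `f`. -/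
def history (f : Cube n → ℝ) (s : A.Seed) (X : ℕ → Cube n) : ℕ → List (Cube n × ℝ)
  | 0 => []
  | i + 1 =>
    match A.step s (history f s X i) with
    | .drawExample => history f s X i ++ [(X i, f (X i))]
    | .valueQuery x => history f s X i ++ [(x, f x)]
    | .output _ => history f s X i

/-- On this run, `A` stops after at most `q` requests (random examples and value queries
together). -/
def HaltsWithin (f : Cube n → ℝ) (s : A.Seed) (X : ℕ → Cube n) (q : ℕ) : Prop :=
  ∃ h, A.step s (A.history f s X q) = .output h

/-- On this run, `A` stops (after some number of requests) and returns the hypothesis `h`. -/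
def Returns (f : Cube n → ℝ) (s : A.Seed) (X : ℕ → Cube n) (h : Cube n → ℝ) : Prop :=
  ∃ i, A.step s (A.history f s X i) = .output h

/-- The joint law of the seed of `A` and of an independent sequence of independent uniformly
distributed points of the cube. -/
def runLaw : Measure (A.Seed × (ℕ → Cube n)) :=
  A.law.prod (Measure.infinitePi fun _ : ℕ => uniform n)

/-- `A` PAC learns the class `F` over the uniform distribution to `ℓ₂` error `ε`: for every
target in `F`, with probability at least `2/3`, `A` returns a hypothesis within `ℓ₂` distance
`ε` of the target. -/
def PACLearns (F : Set (Cube n → ℝ)) (ε : ℝ) : Prop :=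
  ∀ f ∈ F, 2 / 3 ≤ A.runLaw {r | ∃ h, A.Returns f r.1 r.2 h ∧ l2norm (f - h) ≤ ε}

/-- For every target in `F`, almost surely `A` makes at most `q` requests in total. -/
def UsesAtMost (F : Set (Cube n → ℝ)) (q : ℕ) : Prop :=
  ∀ f ∈ F, ∀ᵐ r ∂A.runLaw, A.HaltsWithin f r.1 r.2 q

end Learner

end SubmodularLearning

end

/-!
Fix a set `T` of `2 * m` coordinates, with `m` of order `ε ^ (-4/5)`. The function
`A ↦ min |A| m` on subsets of `T` stays monotone and submodular when its values on an arbitrary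
family `b` of sets of size `m` are lowered by `1/2`: incomparable sets leave a slack of at least
`1` around the layer `m`. After division by `m`, the functions of two families `b` and `b'` are at
squared distance `|b ∆ b'| / (4 m² 4ᵐ)`, and the layer has about `4ᵐ / √m` sets, so an `ℓ₂` ball of
radius `ε` contains only functions whose families pairwise differ on at most `1/16` of the layer.
There are at most `√(2 ^ N)` of these, out of the `2 ^ N` families, where `N` is the size of the
layer.

At each point these functions take only two values, so for fixed random choices a learner with `q`
requests sees at most `2 ^ q` histories and succeeds on at most `2 ^ q √(2 ^ N)` families. Averaging
over the random choices, `2/3 * 2 ^ N ≤ 2 ^ q √(2 ^ N)`. Hence `q` is at least about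
`N / 2 ≥ 2 ^ m`.
-/

namespace SubmodularLearning

open Finset symmDiff

section L2Norm

variable {n : ℕ}

lemma l2norm_eq_norm_div (f : Cube n → ℝ) : l2norm f = ‖WithLp.toLp 2 f‖ / √(2 ^ n) := by
  simp [l2norm, EuclideanSpace.norm_eq, Real.sqrt_div']

lemma l2norm_sub_le_add (f g h : Cube n → ℝ) :
    l2norm (f - g) ≤ l2norm (f - h) + l2norm (g - h) := by
  simp only [l2norm_eq_norm_div, WithLp.toLp_sub, ← dist_eq_norm, ← add_div]
  gcongr
  exact dist_triangle_right _ _ _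

lemma measurableSet_l2norm_sub_le (f : Cube n → ℝ) (ε : ℝ) :
    MeasurableSet {h : Cube n → ℝ | l2norm (f - h) ≤ ε} := by
  refine measurableSet_le ?_ measurable_const
  simp only [l2norm, Pi.sub_apply]
  fun_prop

end L2Norm

/-! ### Perturbed uniform matroid ranks -/

section PerturbedRank

variable {α : Type*} [DecidableEq α] {m : ℕ} {b b' : Finset (Finset α)} {A B : Finset α}

/-- The rank function `A ↦ min #A m` of a uniform matroid, lowered by `1/2` on the sets of size `m`
that belong to `b`. The sets in `b` of any other size play no role. -/
noncomputable def perturbedRank (m : ℕ) (b : Finset (Finset α)) (A : Finset α) : ℝ :=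
  min (#A : ℝ) m - if #A = m ∧ A ∈ b then 1 / 2 else 0

lemma perturbedRank_le_min : perturbedRank m b A ≤ min (#A : ℝ) m := by
  unfold perturbedRank
  split_ifs <;> linarith

lemma min_sub_half_le_perturbedRank : min (#A : ℝ) (m - 1 / 2) ≤ perturbedRank m b A := by
  unfold perturbedRank
  split_ifs with h
  · rw [h.1, min_self]
    exact min_le_right _ _
  · rw [sub_zero]
    exact min_le_min_left _ (by linarith)

lemma perturbedRank_of_lt_card (h : m < #A) : perturbedRank m b A = m := by
  have h' : (m : ℝ) ≤ #A := by exact_mod_cast h.le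
  simp [perturbedRank, h.ne', h']

lemma perturbedRank_nonneg (hm : 0 < m) : 0 ≤ perturbedRank m b A := by
  have hm' : (1 : ℝ) ≤ m := by exact_mod_cast hm
  exact (le_min (Nat.cast_nonneg _) (by linarith)).trans min_sub_half_le_perturbedRank

lemma perturbedRank_mono : Monotone (perturbedRank m b) := by
  intro A B hAB
  rcases hAB.eq_or_ssubset with rfl | hlt
  · rfl
  have hcard : (#A : ℝ) + 1 ≤ #B := by exact_mod_cast card_lt_card hlt
  have hA : perturbedRank m b A ≤ min (#A : ℝ) m := perturbedRank_le_min
  rcases lt_or_ge m #B with hB | hB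
  · rw [perturbedRank_of_lt_card hB]
    exact hA.trans (min_le_right _ _)
  · have hB' : (#B : ℝ) ≤ m := by exact_mod_cast hB
    calc perturbedRank m b A ≤ #A := hA.trans (min_le_left _ _)
      _ ≤ min (#B : ℝ) (m - 1 / 2) := le_min (by linarith) (by linarith)
      _ ≤ perturbedRank m b B := min_sub_half_le_perturbedRank

lemma perturbedRank_union_add_inter_le :
    perturbedRank m b (A ∪ B) + perturbedRank m b (A ∩ B) ≤
      perturbedRank m b A + perturbedRank m b B := by
  by_cases hAB : A ⊆ B
  · rw [union_eq_right.2 hAB, inter_eq_left.2 hAB, add_comm]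
  by_cases hBA : B ⊆ A
  · rw [union_eq_left.2 hBA, inter_eq_right.2 hBA]
  have hA : #(A ∩ B) < #A := card_lt_card (inf_lt_left.2 hAB)
  have hB : #(A ∩ B) < #B := card_lt_card (inf_lt_right.2 hBA)
  have hunion : perturbedRank m b (A ∪ B) ≤ min (#(A ∪ B) : ℝ) m := perturbedRank_le_min
  have hinter : perturbedRank m b (A ∩ B) ≤ min (#(A ∩ B) : ℝ) m := perturbedRank_le_min
  rw [le_min_iff] at hunion hinter
  rcases le_or_gt m #(A ∩ B) with hm | hm
  · rw [perturbedRank_of_lt_card (hm.trans_lt hA), perturbedRank_of_lt_card (hm.trans_lt hB)]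
    exact add_le_add hunion.2 hinter.2
  have hA' : (#(A ∩ B) : ℝ) + 1 ≤ #A := by exact_mod_cast hA
  have hB' : (#(A ∩ B) : ℝ) + 1 ≤ #B := by exact_mod_cast hB
  have hm' : (#(A ∩ B) : ℝ) + 1 ≤ m := by exact_mod_cast hm
  have hmodular : (#(A ∪ B) : ℝ) + #(A ∩ B) = #A + #B := by
    exact_mod_cast card_union_add_card_inter A B
  calc perturbedRank m b (A ∪ B) + perturbedRank m b (A ∩ B)
      ≤ min (#A : ℝ) (m - 1 / 2) + min (#B : ℝ) (m - 1 / 2) := by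
        rcases min_cases (#A : ℝ) (m - 1 / 2) with h | h <;>
          rcases min_cases (#B : ℝ) (m - 1 / 2) with h' | h' <;> linarith
    _ ≤ perturbedRank m b A + perturbedRank m b B :=
        add_le_add min_sub_half_le_perturbedRank min_sub_half_le_perturbedRank

lemma sq_perturbedRank_sub (hb : ∀ A ∈ b, #A = m) (hb' : ∀ A ∈ b', #A = m) (A : Finset α) :
    (perturbedRank m b A - perturbedRank m b' A) ^ 2 = if A ∈ b ∆ b' then 1 / 4 else 0 := by
  simp only [perturbedRank, and_iff_right_of_imp (hb A), and_iff_right_of_imp (hb' A)]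
  by_cases h : A ∈ b <;> by_cases h' : A ∈ b' <;> norm_num [h, h', mem_symmDiff]

end PerturbedRank

/-! ### Hard targets -/

section HardTarget

variable {n m : ℕ} {T : Finset (Fin n)} {b b' : Finset (Finset (Fin n))}

/-- The part in `T` of the subset of `Fin n` that `x` represents. -/
def supp (T : Finset (Fin n)) (x : Cube n) : Finset (Fin n) := {i ∈ T | x i = true}

lemma supp_sup (T : Finset (Fin n)) (x y : Cube n) : supp T (x ⊔ y) = supp T x ∪ supp T y := by
  simp only [supp, Pi.sup_apply, ← filter_or, Bool.max_eq_or, Bool.or_eq_true]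

lemma supp_inf (T : Finset (Fin n)) (x y : Cube n) : supp T (x ⊓ y) = supp T x ∩ supp T y := by
  simp only [supp, Pi.inf_apply, ← filter_and, Bool.min_eq_and, Bool.and_eq_true]

lemma supp_mono : Monotone (supp T) := fun x y hxy => by
  rw [← sup_eq_right.2 hxy, supp_sup]
  exact subset_union_left

lemma card_filter_supp_eq {A : Finset (Fin n)} (hA : A ⊆ T) :
    #{x : Cube n | supp T x = A} = 2 ^ (n - #T) := by
  have hfiber : ({x : Cube n | supp T x = A} : Finset (Cube n)) =
      Fintype.piFinset fun i => if i ∈ T then {decide (i ∈ A)} else univ := by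
    ext x
    rw [mem_filter_univ, Fintype.mem_piFinset, Finset.ext_iff]
    refine forall_congr' fun i => ?_
    rw [supp, mem_filter]
    have := @hA i
    by_cases hT : i ∈ T <;> by_cases hi : i ∈ A <;> simp_all
  rw [hfiber, Fintype.card_piFinset]
  simp [apply_ite card, prod_ite, filter_not, card_univ_sdiff]

lemma card_filter_supp_mem {S : Finset (Finset (Fin n))} (hS : S ⊆ T.powerset) :
    #{x : Cube n | supp T x ∈ S} = #S * 2 ^ (n - #T) := by
  have hmaps : Set.MapsTo (supp T) ({x : Cube n | supp T x ∈ S} : Finset (Cube n)) S :=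
    fun x hx => (mem_filter.1 hx).2
  rw [card_eq_sum_card_fiberwise hmaps, ← smul_eq_mul, ← sum_const]
  refine sum_congr rfl fun A hA => ?_
  rw [← card_filter_supp_eq (mem_powerset.1 (hS hA)), filter_filter]
  congr 1
  ext x
  simp only [mem_filter_univ, and_iff_right_iff_imp]
  rintro rfl
  exact hA

/-- The perturbed rank, normalized to range `[0,1]`, of the part of the input in `T`. Recovering the
family `b` is what makes it hard to learn. -/
noncomputable def hardTarget (T : Finset (Fin n)) (m : ℕ) (b : Finset (Finset (Fin n)))
    (x : Cube n) : ℝ :=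
  perturbedRank m b (supp T x) / m

lemma hardTarget_mem_monotoneSubmodular (hm : 0 < m) :
    hardTarget T m b ∈ monotoneSubmodular n := by
  have hm' : (0 : ℝ) < m := by exact_mod_cast hm
  refine ⟨fun x y hxy => ?_, fun x y => ?_, fun x => ⟨?_, ?_⟩⟩
  · exact div_le_div_of_nonneg_right (perturbedRank_mono (supp_mono hxy)) hm'.le
  · simp only [hardTarget, supp_sup, supp_inf, ← add_div]
    exact div_le_div_of_nonneg_right perturbedRank_union_add_inter_le hm'.le
  · exact div_nonneg (perturbedRank_nonneg hm) hm'.le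
  · exact (div_le_one hm').2 (perturbedRank_le_min.trans (min_le_right _ _))

lemma card_image_hardTarget_le_two (T : Finset (Fin n)) (m : ℕ)
    (P : Finset (Finset (Finset (Fin n)))) (x : Cube n) :
    #(P.image fun b => hardTarget T m b x) ≤ 2 := by
  have hpair : (P.image fun b => hardTarget T m b x) ⊆
      {(min (#(supp T x) : ℝ) m - 1 / 2) / m, (min (#(supp T x) : ℝ) m - 0) / m} := by
    refine image_subset_iff.2 fun b _ => ?_
    unfold hardTarget perturbedRank
    split_ifs <;> simp
  exact (card_le_card hpair).trans card_le_two

lemma sq_l2norm_hardTarget_sub (hb : b ⊆ T.powersetCard m) (hb' : b' ⊆ T.powersetCard m) :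
    l2norm (hardTarget T m b - hardTarget T m b') ^ 2 = #(b ∆ b') / (4 * m ^ 2 * 2 ^ #T) := by
  have hsq : ∀ x, (hardTarget T m b - hardTarget T m b') x ^ 2 =
      if supp T x ∈ b ∆ b' then 1 / 4 / (m : ℝ) ^ 2 else 0 := fun x => by
    rw [Pi.sub_apply, hardTarget, hardTarget, ← sub_div, div_pow,
      sq_perturbedRank_sub (fun A hA => (mem_powersetCard.1 (hb hA)).2)
        fun A hA => (mem_powersetCard.1 (hb' hA)).2, ite_div, zero_div]
  have hlayer : b ∆ b' ⊆ T.powerset :=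
    (symmDiff_subset_union.trans (union_subset hb hb')).trans fun A hA =>
      mem_powerset.2 (mem_powersetCard.1 hA).1
  have hpow : (2 : ℝ) ^ n = 2 ^ #T * 2 ^ (n - #T) := by
    rw [← pow_add, Nat.add_sub_cancel' (card_finset_fin_le T)]
  rw [l2norm, Real.sq_sqrt (by positivity), sum_congr rfl fun x _ => hsq x, ← sum_filter,
    sum_const, card_filter_supp_mem hlayer, hpow, nsmul_eq_mul]
  push_cast
  field_simp

end HardTarget

/-! ### Sparse sets and central binomial coefficients -/

lemma card_le_card_filter_card_le_of_card_symmDiff_le {α : Type*} [DecidableEq α] {P : Finset α}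
    {S : Finset (Finset α)} {r : ℕ} (hS : S ⊆ P.powerset)
    (hr : ∀ b ∈ S, ∀ b' ∈ S, #(b ∆ b') ≤ r) : #S ≤ #{d ∈ P.powerset | #d ≤ r} := by
  obtain rfl | ⟨b₀, hb₀⟩ := S.eq_empty_or_nonempty
  · exact Nat.zero_le _
  have hsub : ∀ b ∈ S, b ∆ b₀ ⊆ P := fun b hb => symmDiff_subset_union.trans
    (union_subset (mem_powerset.1 (hS hb)) (mem_powerset.1 (hS hb₀)))
  exact card_le_card_of_injOn (· ∆ b₀)
    (fun b hb => mem_filter.2 ⟨mem_powerset.2 (hsub b hb), hr b hb b₀ hb₀⟩)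
    (symmDiff_left_injective b₀).injOn

lemma card_filter_card_le_mul_pow_le {α : Type*} (P : Finset α) (r : ℕ) {t : ℕ} (ht : 0 < t) :
    #{d ∈ P.powerset | #d ≤ r} * t ^ (#P - r) ≤ (t + 1) ^ #P := by
  calc #{d ∈ P.powerset | #d ≤ r} * t ^ (#P - r)
      = ∑ d ∈ P.powerset with #d ≤ r, t ^ (#P - r) := by rw [sum_const, smul_eq_mul]
    _ ≤ ∑ d ∈ P.powerset with #d ≤ r, 1 ^ #d * t ^ (#P - #d) := by
        refine sum_le_sum fun d hd => ?_
        rw [one_pow, one_mul]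
        exact Nat.pow_le_pow_right ht (Nat.sub_le_sub_left (mem_filter.1 hd).2 _)
    _ ≤ ∑ d ∈ P.powerset, 1 ^ #d * t ^ (#P - #d) := sum_le_sum_of_subset (filter_subset _ _)
    _ = (t + 1) ^ #P := by rw [sum_pow_mul_eq_add_pow, add_comm]

lemma sq_card_filter_card_le_le_two_pow {α : Type*} {P : Finset α} {r : ℕ} (hr : 16 * r ≤ #P) :
    #{d ∈ P.powerset | #d ≤ r} ^ 2 ≤ 2 ^ #P := by
  set V := #{d ∈ P.powerset | #d ≤ r}
  -- The parameter `t = 4` suffices, since `5 ^ 16 ≤ 4 ^ 19`.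
  have hV : V * 4 ^ (#P - r) ≤ 5 ^ #P := card_filter_card_le_mul_pow_le P r (by norm_num)
  have hpow : V ^ 16 * 4 ^ (15 * #P) ≤ (2 ^ #P) ^ 8 * 4 ^ (15 * #P) :=
    calc V ^ 16 * 4 ^ (15 * #P) ≤ V ^ 16 * 4 ^ ((#P - r) * 16) :=
        Nat.mul_le_mul_left _ (Nat.pow_le_pow_right (by norm_num) (by omega))
      _ = (V * 4 ^ (#P - r)) ^ 16 := by rw [mul_pow, pow_mul]
      _ ≤ (5 ^ #P) ^ 16 := by gcongr
      _ = (5 ^ 16) ^ #P := pow_right_comm _ _ _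
      _ ≤ (2 ^ 8 * 4 ^ 15) ^ #P := by gcongr; norm_num
      _ = (2 ^ #P) ^ 8 * 4 ^ (15 * #P) := by rw [mul_pow, pow_right_comm, pow_mul]
  refine (Nat.pow_le_pow_iff_left (n := 8) (by norm_num)).1 ?_
  rw [← pow_mul]
  exact Nat.le_of_mul_le_mul_right hpow (by positivity)

lemma sixteen_pow_le_mul_sq_centralBinom {m : ℕ} (hm : 0 < m) :
    16 ^ m ≤ 4 * m * m.centralBinom ^ 2 := by
  induction m, hm using Nat.le_induction with
  | base => simp [Nat.centralBinom, Nat.choose]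
  | succ m _ ih =>
    refine Nat.le_of_mul_le_mul_left (c := m + 1) ?_ (by positivity)
    calc (m + 1) * 16 ^ (m + 1) = 16 * (m + 1) * 16 ^ m := by ring
      _ ≤ 16 * (m + 1) * (4 * m * m.centralBinom ^ 2) := by gcongr
      _ = 16 * (4 * m * (m + 1)) * m.centralBinom ^ 2 := by ring
      _ ≤ 16 * (2 * m + 1) ^ 2 * m.centralBinom ^ 2 := by gcongr; nlinarith
      _ = 4 * (2 * (2 * m + 1) * m.centralBinom) ^ 2 := by ring
      _ = 4 * ((m + 1) * (m + 1).centralBinom) ^ 2 := by rw [Nat.succ_mul_centralBinom_succ]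
      _ = (m + 1) * (4 * (m + 1) * (m + 1).centralBinom ^ 2) := by ring

lemma two_pow_succ_lt_centralBinom {m : ℕ} (hm : 4 ≤ m) : 2 ^ (m + 1) < m.centralBinom := by
  induction m, hm using Nat.le_induction with
  | base => decide
  | succ m _ ih =>
    refine lt_of_mul_lt_mul_left (a := m + 1) ?_ (by positivity)
    calc (m + 1) * 2 ^ (m + 1 + 1) = 2 * (m + 1) * 2 ^ (m + 1) := by ring
      _ < 2 * (m + 1) * m.centralBinom := by gcongr
      _ ≤ 2 * (2 * m + 1) * m.centralBinom := by gcongr; omega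
      _ = (m + 1) * (m + 1).centralBinom := (Nat.succ_mul_centralBinom_succ m).symm

/-! ### Runs of a learner -/

lemma Action.measurableSet_of_preimage_output {n : ℕ} {S : Set (Action n)}
    (hS : MeasurableSet (Action.output ⁻¹' S)) : MeasurableSet S := by
  have htoSum : Function.Injective (Action.toSum (n := n)) := by
    rintro (_ | x | h) (_ | x | h) <;> simp [Action.toSum]
  refine ⟨Action.toSum '' S, ?_, htoSum.preimage_image S⟩
  refine measurableSet_sum_iff.2 ⟨.of_discrete, measurableSet_sum_iff.2 ⟨.of_discrete, ?_⟩⟩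
  convert hS using 1
  ext h
  exact htoSum.mem_set_image (a := .output h)

/-- The point whose label an action requests, if any, when the next random example is at `x`. -/
def Action.request {n : ℕ} (x : Cube n) : Action n → Option (Cube n)
  | .drawExample => some x
  | .valueQuery y => some y
  | .output _ => none

lemma Action.measurableSet_request_eq {n : ℕ} (x : Cube n) (o : Option (Cube n)) :
    MeasurableSet {a : Action n | a.request x = o} :=
  measurableSet_of_preimage_output (MeasurableSet.const (none = o))

lemma Action.measurableSet_exists_output {n : ℕ} {S : Set (Cube n → ℝ)} (hS : MeasurableSet S) :
    MeasurableSet {a : Action n | ∃ h, a = .output h ∧ h ∈ S} :=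
  measurableSet_of_preimage_output (by simpa using hS)

namespace Learner

variable {n : ℕ} (A : Learner n)

/-- On the run `r`, after `q` requests or earlier, `A` has stopped with a hypothesis within `ℓ₂`
distance `ε` of the target `f`. -/
def Succeeds (f : Cube n → ℝ) (q : ℕ) (ε : ℝ) (r : A.Seed × (ℕ → Cube n)) : Prop :=
  ∃ h, A.step r.1 (A.history f r.1 r.2 q) = .output h ∧ l2norm (f - h) ≤ ε

lemma history_succ (f : Cube n → ℝ) (s : A.Seed) (X : ℕ → Cube n) (i : ℕ) :
    A.history f s X (i + 1) = A.history f s X i ++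
      ((A.step s (A.history f s X i)).request (X i)).toList.map fun x => (x, f x) := by
  rw [history]
  rcases A.step s (A.history f s X i) with _ | x | h <;> simp [Action.request]

section Halting

variable {A} {f h : Cube n → ℝ} {s : A.Seed} {X : ℕ → Cube n} {i j q : ℕ}

lemma history_eq_of_step_eq_output (hi : A.step s (A.history f s X i) = .output h)
    (hij : i ≤ j) : A.history f s X j = A.history f s X i := by
  induction j, hij using Nat.le_induction with
  | base => rfl
  | succ j _ ih => simp [history_succ, ih, hi, Action.request]

lemma step_history_eq_of_returns (hq : A.HaltsWithin f s X q) (hh : A.Returns f s X h) :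
    A.step s (A.history f s X q) = .output h := by
  obtain ⟨h', hq⟩ := hq
  obtain ⟨i, hi⟩ := hh
  rcases le_total i q with hiq | hqi
  · rw [history_eq_of_step_eq_output hi hiq, hi]
  · rwa [history_eq_of_step_eq_output hq hqi] at hi

lemma two_thirds_le_runLaw_succeeds {F : Set (Cube n → ℝ)} {ε : ℝ} (hA : A.PACLearns F ε)
    (hq : A.UsesAtMost F q) (hf : f ∈ F) : 2 / 3 ≤ A.runLaw {r | A.Succeeds f q ε r} := by
  refine (hA f hf).trans (measure_mono_ae ?_)
  filter_upwards [hq f hf] with r hhalts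
  rintro ⟨h, hreturns, hclose⟩
  exact ⟨h, step_history_eq_of_returns hhalts hreturns, hclose⟩

end Halting

lemma measurableSet_history (f : Cube n → ℝ)
    {p : A.Seed × (ℕ → Cube n) → List (Cube n × ℝ) → Prop}
    (hp : ∀ l, MeasurableSet {r | p r l}) (i : ℕ) :
    MeasurableSet {r | p r (A.history f r.1 r.2 i)} := by
  induction i generalizing p with
  | zero => exact hp []
  | succ i ih =>
    simp only [history_succ]
    refine ih (p := fun r l => p r (l ++ ((A.step r.1 l).request (r.2 i)).toList.map _)) fun l => ?_
    have hunion : {r : A.Seed × (ℕ → Cube n) |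
          p r (l ++ ((A.step r.1 l).request (r.2 i)).toList.map fun x => (x, f x))} =
        ⋃ (x : Cube n) (o : Option (Cube n)), {r | r.2 i = x} ∩
          ({r | (A.step r.1 l).request x = o} ∩
            {r | p r (l ++ o.toList.map fun x => (x, f x))}) := by
      ext r
      simp
    have hX : Measurable fun r : A.Seed × (ℕ → Cube n) => r.2 i := by fun_prop
    have hstep : Measurable fun r : A.Seed × (ℕ → Cube n) => A.step r.1 l :=
      (A.measurable_step l).comp measurable_fst
    rw [hunion]
    exact .iUnion fun x => .iUnion fun o => (hX (measurableSet_singleton x)).inter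
      ((hstep (Action.measurableSet_request_eq x o)).inter (hp _))

lemma measurableSet_succeeds (f : Cube n → ℝ) (q : ℕ) (ε : ℝ) :
    MeasurableSet {r | A.Succeeds f q ε r} :=
  A.measurableSet_history f (fun l => (A.measurable_step l).comp measurable_fst
    (Action.measurableSet_exists_output (measurableSet_l2norm_sub_le f ε))) q

instance isProbabilityMeasure_runLaw : IsProbabilityMeasure A.runLaw := by
  have : IsProbabilityMeasure (uniform n) := PMF.toMeasure.isProbabilityMeasure _
  unfold runLaw
  infer_instance

section FewTargets

variable {ι : Type*} {B : Finset ι} {G : ι → Cube n → ℝ} {k K : ℕ} {ε : ℝ}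

lemma card_image_history_le (hG : ∀ x, #(B.image (G · x)) ≤ k) (s : A.Seed) (X : ℕ → Cube n)
    (i : ℕ) : #(B.image fun b => A.history (G b) s X i) ≤ k ^ i := by
  induction i with
  | zero => exact card_le_one.2 (by simp +contextual [history])
  | succ i ih =>
    let extend (l : List (Cube n × ℝ)) (b : ι) : List (Cube n × ℝ) :=
      l ++ ((A.step s l).request (X i)).toList.map fun x => (x, G b x)
    have hextend (l : List (Cube n × ℝ)) : #(B.image (extend l)) ≤ k := by
      -- If nothing is requested, the extension is constant, hence a function of any label.
      obtain ⟨x, φ, hφ⟩ : ∃ (x : Cube n) (φ : ℝ → List (Cube n × ℝ)),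
          extend l = φ ∘ (G · x) := by
        rcases ho : (A.step s l).request (X i) with _ | x
        · exact ⟨X i, fun _ => l, by ext1 b; simp [extend, ho]⟩
        · exact ⟨x, fun v => l ++ [(x, v)], by ext1 b; simp [extend, ho]⟩
      rw [hφ, ← image_image]
      exact card_image_le.trans (hG x)
    have hsub : (B.image fun b => A.history (G b) s X (i + 1)) ⊆
        (B.image fun b => A.history (G b) s X i).biUnion fun l => B.image (extend l) :=
      image_subset_iff.2 fun b hb => mem_biUnion.2
        ⟨_, mem_image_of_mem _ hb, mem_image.2 ⟨b, hb, (A.history_succ _ s X i).symm⟩⟩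
    calc #(B.image fun b => A.history (G b) s X (i + 1))
        ≤ #(B.image fun b => A.history (G b) s X i) * k :=
          (card_le_card hsub).trans (card_biUnion_le_card_mul _ _ _ fun l _ => hextend l)
      _ ≤ k ^ (i + 1) := by rw [pow_succ]; gcongr

open scoped Classical in
lemma card_filter_succeeds_le (hG : ∀ x, #(B.image (G · x)) ≤ k)
    (hK : ∀ h, #{b ∈ B | l2norm (G b - h) ≤ ε} ≤ K) (q : ℕ) (r : A.Seed × (ℕ → Cube n)) :
    #{b ∈ B | A.Succeeds (G b) q ε r} ≤ K * k ^ q := by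
  set S := {b ∈ B | A.Succeeds (G b) q ε r}
  let H (b : ι) := A.history (G b) r.1 r.2 q
  have hfiber : ∀ l ∈ S.image H, #{b ∈ S | H b = l} ≤ K := by
    intro l hl
    obtain ⟨b₀, hb₀, rfl⟩ := mem_image.1 hl
    obtain ⟨-, h, hstep, -⟩ := mem_filter.1 hb₀
    refine (card_le_card fun b hb => ?_).trans (hK h)
    obtain ⟨hbS, hH⟩ := mem_filter.1 hb
    obtain ⟨hbB, h', hstep', hclose⟩ := mem_filter.1 hbS
    obtain rfl : h' = h :=
      Action.output.inj (hstep'.symm.trans ((congrArg (A.step r.1) hH).trans hstep))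
    exact mem_filter.2 ⟨hbB, hclose⟩
  calc #S ≤ K * #(S.image H) := card_le_mul_card_image S K hfiber
    _ ≤ K * #(B.image H) := by gcongr; exact filter_subset _ _
    _ ≤ K * k ^ q := by gcongr; exact A.card_image_history_le hG r.1 r.2 q

end FewTargets

end Learner

open scoped Classical in
lemma sum_measure_le_mul_measure_univ {Ω ι : Type*} [MeasurableSpace Ω] (μ : Measure Ω)
    (B : Finset ι) {E : ι → Set Ω} (hE : ∀ b ∈ B, MeasurableSet (E b)) {N : ℕ}
    (hN : ∀ ω, #{b ∈ B | ω ∈ E b} ≤ N) : ∑ b ∈ B, μ (E b) ≤ N * μ Set.univ := by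
  calc ∑ b ∈ B, μ (E b) = ∑ b ∈ B, ∫⁻ ω, (E b).indicator 1 ω ∂μ :=
        sum_congr rfl fun b hb => (lintegral_indicator_one (hE b hb)).symm
    _ = ∫⁻ ω, ∑ b ∈ B, (E b).indicator 1 ω ∂μ :=
        (lintegral_finsetSum _ fun b hb => measurable_one.indicator (hE b hb)).symm
    _ = ∫⁻ ω, (#{b ∈ B | ω ∈ E b} : ENNReal) ∂μ := by simp [Set.indicator_apply]
    _ ≤ ∫⁻ _, (N : ENNReal) ∂μ := lintegral_mono fun ω => Nat.cast_le.2 (hN ω)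
    _ = N * μ Set.univ := lintegral_const _

theorem Learner.two_mul_card_le_of_pacLearns {n : ℕ} {A : Learner n}
    {F : Set (Cube n → ℝ)} {ε : ℝ} {q : ℕ} (hA : A.PACLearns F ε) (hq : A.UsesAtMost F q)
    {ι : Type*} {B : Finset ι} {G : ι → Cube n → ℝ} {k K : ℕ} (hF : ∀ b ∈ B, G b ∈ F)
    (hG : ∀ x, #(B.image (G · x)) ≤ k) (hK : ∀ h, #{b ∈ B | l2norm (G b - h) ≤ ε} ≤ K) :
    2 * #B ≤ 3 * (K * k ^ q) := by
  have haverage : (#B : ENNReal) * (2 / 3) ≤ (K * k ^ q : ℕ) :=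
    calc (#B : ENNReal) * (2 / 3) = ∑ b ∈ B, (2 / 3 : ENNReal) := by simp
      _ ≤ ∑ b ∈ B, A.runLaw {r | A.Succeeds (G b) q ε r} :=
          sum_le_sum fun b hb => two_thirds_le_runLaw_succeeds hA hq (hF b hb)
      _ ≤ (K * k ^ q : ℕ) * A.runLaw Set.univ :=
          sum_measure_le_mul_measure_univ _ _ (fun b _ => A.measurableSet_succeeds _ _ _)
            (A.card_filter_succeeds_le hG hK q)
      _ = (K * k ^ q : ℕ) := by rw [measure_univ, mul_one]
  have hreal := ENNReal.toReal_mono (ENNReal.natCast_ne_top _) haverage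
  simp only [ENNReal.toReal_mul, ENNReal.toReal_natCast, ENNReal.toReal_div,
    ENNReal.toReal_ofNat] at hreal
  have : (2 * #B : ℝ) ≤ 3 * (K * k ^ q : ℕ) := by linarith
  exact_mod_cast this

/-! ### The lower bound -/

lemma sixteen_mul_card_symmDiff_le_centralBinom {n m : ℕ} {δ : ℝ} (hm : 0 < m)
    (hδ : (m : ℝ) ^ 5 * δ ^ 4 * 2 ^ 14 ≤ 1) {T : Finset (Fin n)} (hT : #T = 2 * m)
    {b b' : Finset (Finset (Fin n))} (hb : b ⊆ T.powersetCard m) (hb' : b' ⊆ T.powersetCard m)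
    (hdist : l2norm (hardTarget T m b - hardTarget T m b') ≤ δ) :
    16 * #(b ∆ b') ≤ m.centralBinom := by
  have : (0 : ℝ) < m := by exact_mod_cast hm
  have hsq : (#(b ∆ b') : ℝ) ≤ δ ^ 2 * (4 * m ^ 2 * 4 ^ m) := by
    have hpow : (4 : ℝ) ^ m = 2 ^ #T := by rw [hT, pow_mul]; norm_num
    rw [hpow, ← div_le_iff₀ (by positivity), ← sq_l2norm_hardTarget_sub hb hb']
    exact pow_le_pow_left₀ (Real.sqrt_nonneg _) hdist 2
  have hbinom : (16 : ℝ) ^ m ≤ 4 * m * m.centralBinom ^ 2 := by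
    exact_mod_cast sixteen_pow_le_mul_sq_centralBinom hm
  have hfinal : (16 * (#(b ∆ b') : ℝ)) ^ 2 ≤ (m.centralBinom : ℝ) ^ 2 :=
    calc (16 * (#(b ∆ b') : ℝ)) ^ 2 ≤ (16 * (δ ^ 2 * (4 * m ^ 2 * 4 ^ m))) ^ 2 := by gcongr
      _ = 2 ^ 12 * m ^ 4 * δ ^ 4 * 16 ^ m := by
        rw [show (16 : ℝ) = 4 ^ 2 by norm_num, ← pow_mul, mul_comm 2 m, pow_mul]
        ring
      _ ≤ 2 ^ 12 * m ^ 4 * δ ^ 4 * (4 * m * m.centralBinom ^ 2) := by gcongr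
      _ = (m : ℝ) ^ 5 * δ ^ 4 * 2 ^ 14 * m.centralBinom ^ 2 := by ring
      _ ≤ 1 * m.centralBinom ^ 2 := by gcongr
      _ = (m.centralBinom : ℝ) ^ 2 := one_mul _
  exact_mod_cast le_of_sq_le_sq hfinal (by positivity)

lemma exists_forall_card_filter_l2norm_hardTarget_sub_le {n m : ℕ} {ε : ℝ} (hm : 0 < m)
    (hε : (m : ℝ) ^ 5 * ε ^ 4 * 2 ^ 18 ≤ 1) {T : Finset (Fin n)} (hT : #T = 2 * m) :
    ∃ K : ℕ, K ^ 2 ≤ 2 ^ m.centralBinom ∧ ∀ h,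
      #{b ∈ (T.powersetCard m).powerset | l2norm (hardTarget T m b - h) ≤ ε} ≤ K := by
  have hP : #(T.powersetCard m) = m.centralBinom := by
    rw [card_powersetCard, hT, Nat.centralBinom]
  refine ⟨_, hP ▸ sq_card_filter_card_le_le_two_pow (Nat.mul_div_le _ 16), fun h =>
    card_le_card_filter_card_le_of_card_symmDiff_le (filter_subset _ _) fun b hb b' hb' => ?_⟩
  obtain ⟨hb, hbh⟩ := mem_filter.1 hb
  obtain ⟨hb', hbh'⟩ := mem_filter.1 hb'
  have hdist : l2norm (hardTarget T m b - hardTarget T m b') ≤ 2 * ε :=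
    (l2norm_sub_le_add _ _ h).trans (by linarith)
  rw [Nat.le_div_iff_mul_le (by norm_num), mul_comm]
  exact sixteen_mul_card_symmDiff_le_centralBinom hm (by linarith) hT
    (mem_powerset.1 hb) (mem_powerset.1 hb') hdist

lemma le_two_mul_add_one_of_two_mul_two_pow_le {N K q : ℕ} (hK : K ^ 2 ≤ 2 ^ N)
    (h : 2 * 2 ^ N ≤ 3 * (K * 2 ^ q)) : N ≤ 2 * q + 1 := by
  have hsq : 2 ^ N * (4 * 2 ^ N) ≤ 2 ^ N * (9 * 2 ^ (2 * q)) :=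
    calc 2 ^ N * (4 * 2 ^ N) = (2 * 2 ^ N) ^ 2 := by ring
      _ ≤ (3 * (K * 2 ^ q)) ^ 2 := by gcongr
      _ = K ^ 2 * (9 * 2 ^ (2 * q)) := by ring
      _ ≤ 2 ^ N * (9 * 2 ^ (2 * q)) := by gcongr
  have hle : 4 * 2 ^ N ≤ 9 * 2 ^ (2 * q) := Nat.le_of_mul_le_mul_left hsq (by positivity)
  have hlt : 2 ^ N < 2 ^ (2 * q + 2) := by
    have : 0 < 2 ^ (2 * q) := by positivity
    rw [pow_add]
    omega
  exact Nat.lt_succ_iff.1 ((Nat.pow_lt_pow_iff_right one_lt_two).1 hlt)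

theorem Learner.two_pow_le_of_pacLearns {n m : ℕ} {ε : ℝ} (hm : 4 ≤ m) (hn : 2 * m ≤ n)
    (hε : (m : ℝ) ^ 5 * ε ^ 4 * 2 ^ 18 ≤ 1) {A : Learner n}
    (hA : A.PACLearns (monotoneSubmodular n) ε) {q : ℕ}
    (hq : A.UsesAtMost (monotoneSubmodular n) q) : 2 ^ m ≤ q := by
  have hm0 : 0 < m := by omega
  obtain ⟨T, -, hT⟩ : ∃ T ⊆ (univ : Finset (Fin n)), #T = 2 * m :=
    exists_subset_card_eq (by simpa using hn)
  obtain ⟨K, hK, hball⟩ := exists_forall_card_filter_l2norm_hardTarget_sub_le hm0 hε hT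
  have hcount := two_mul_card_le_of_pacLearns hA hq
    (fun _ _ => hardTarget_mem_monotoneSubmodular hm0) (card_image_hardTarget_le_two T m _) hball
  rw [card_powerset, card_powersetCard, hT, ← Nat.centralBinom] at hcount
  have hlower := le_two_mul_add_one_of_two_mul_two_pow_le hK hcount
  have hlayer := two_pow_succ_lt_centralBinom hm
  rw [pow_succ] at hlayer
  omega

lemma rpow_neg_four_fifths_pow_five_mul {ε : ℝ} (hε : 0 < ε) :
    (ε ^ (-(4 / 5) : ℝ)) ^ 5 * ε ^ 4 = 1 := by
  rw [← Real.rpow_natCast _ 5, ← Real.rpow_natCast ε 4, ← Real.rpow_mul hε.le,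
    ← Real.rpow_add hε]
  norm_num

lemma two_hundred_fifty_six_le_rpow_neg_four_fifths {ε : ℝ} (hε : 0 < ε) (hε₀ : ε ≤ 1 / 1024) :
    256 ≤ ε ^ (-(4 / 5) : ℝ) :=
  calc (256 : ℝ) = (2 ^ (-10 : ℝ)) ^ (-(4 / 5) : ℝ) := by
        rw [← Real.rpow_mul zero_le_two]; norm_num
    _ = (1 / 1024) ^ (-(4 / 5) : ℝ) := by congr 1; norm_num [Real.rpow_neg]
    _ ≤ ε ^ (-(4 / 5) : ℝ) := Real.rpow_le_rpow_of_nonpos hε hε₀ (by norm_num)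

lemma exists_layer_size {ε : ℝ} (hε : 0 < ε) (hε₀ : ε ≤ 1 / 1024) :
    ∃ m : ℕ, 4 ≤ m ∧ ε ^ (-(4 / 5) : ℝ) ≤ 32 * m ∧ 16 * m ≤ ε ^ (-(4 / 5) : ℝ) ∧
      (m : ℝ) ^ 5 * ε ^ 4 * 2 ^ 18 ≤ 1 := by
  have hE := two_hundred_fifty_six_le_rpow_neg_four_fifths hε hε₀
  have hE5 := rpow_neg_four_fifths_pow_five_mul hε
  set E := ε ^ (-(4 / 5) : ℝ)
  have hfloor : (⌊E / 16⌋₊ : ℝ) ≤ E / 16 := Nat.floor_le (by positivity)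
  have hlt : E / 16 < ⌊E / 16⌋₊ + 1 := Nat.lt_floor_add_one _
  refine ⟨⌊E / 16⌋₊, Nat.le_floor (by push_cast; linarith), by linarith, by linarith, ?_⟩
  calc (⌊E / 16⌋₊ : ℝ) ^ 5 * ε ^ 4 * 2 ^ 18 ≤ (E / 16) ^ 5 * ε ^ 4 * 2 ^ 18 := by gcongr
    _ = E ^ 5 * ε ^ 4 * (1 / 4) := by ring
    _ ≤ 1 := by rw [hE5]; norm_num

end SubmodularLearning

theorem mainTheorem9 :
    ∃ c C ε₀ : ℝ, 0 < c ∧ 0 < C ∧ 0 < ε₀ ∧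
      ∀ ε : ℝ, 0 < ε → ε ≤ ε₀ →
        ∀ n : ℕ, C * ε ^ (-(4 / 5) : ℝ) ≤ (n : ℝ) →
          ∀ A : SubmodularLearning.Learner n,
            A.PACLearns (SubmodularLearning.monotoneSubmodular n) ε →
              ∀ q : ℕ, A.UsesAtMost (SubmodularLearning.monotoneSubmodular n) q →
                (2 : ℝ) ^ (c * ε ^ (-(4 / 5) : ℝ)) ≤ (q : ℝ) := by
  refine ⟨1 / 32, 1 / 8, 1 / 1024, by norm_num, by norm_num, by norm_num, ?_⟩
  intro ε hε hε₀ n hn A hA q hq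
  obtain ⟨m, hm, hεm, hmε, hmε5⟩ := SubmodularLearning.exists_layer_size hε hε₀
  have hmn : 2 * m ≤ n := by
    have : (2 * m : ℝ) ≤ n := by linarith
    exact_mod_cast this
  have hq : 2 ^ m ≤ q := SubmodularLearning.Learner.two_pow_le_of_pacLearns hm hmn hmε5 hA hq
  calc (2 : ℝ) ^ (1 / 32 * ε ^ (-(4 / 5) : ℝ)) ≤ 2 ^ (m : ℝ) :=
        Real.rpow_le_rpow_of_exponent_le one_le_two (by linarith)
    _ = 2 ^ m := Real.rpow_natCast 2 m
    _ ≤ q := by exact_mod_cast hq
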